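/- Let $d\in\mathbb N$ and let $\mu_1,\mu_2,\nu_1,\nu_2$ be Borel probability measures on $\mathbb R^d$ (with the Euclidean norm) with bounded supports, such that $\operatorname{supp}\mu_1\cap\operatorname{supp}\mu_2=\emptyset$ and $\operatorname{supp}\nu_1\cap\operatorname{supp}\nu_2=\emptyset$. Write $r_{\mu_i}$, $r_{\nu_i}$ for the diameters of the supports of $\mu_i$, $\nu_i$, and, with $d(A,B)=\inf_{a\in A,\,b\in B}\|a-b\|$, put $$l_i=d(\operatorname{supp}\mu_i,\operatorname{supp}\nu_i),\qquad L_1=d(\operatorname{supp}\mu_1,\operatorname{supp}\nu_2),\qquad L_2=d(\operatorname{supp}\mu_2,\operatorname{supp}\nu_1).$$ Let $W_1(\mu,\nu)=\inf_{\gamma}\int\|x-y\|\,d\gamma(x,y)$, the infimum over all couplings $\gamma$ of $\mu$ and $\nu$. Let $p^*\in(0,1)$ and $\mu=p^*\mu_1+(1-p^*)\mu_2$, and suppose that $$L_i\ \ge\ l_i+r_{\nu_1}+r_{\nu_2}+r_{\mu_1}+r_{\mu_2}\qquad(i=1,2).$$ Then $p^*$ minimizes $p\mapsto W_1\bigl(\mu,\,p\nu_1+(1-p)\nu_2\bigr)$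 over $p\in[0,1]$. Moreover it is the only minimizer, $$\operatorname*{arg\,min}_{p\in[0,1]}W_1\bigl(\mu,\,p\nu_1+(1-p)\nu_2\bigr)=\{p^*\},$$ provided that either for each $i\in\{1,2\}$ at least one of $\mu_i,\nu_i$ is not a point mass (which holds in particular if $\nu_1$ and $\nu_2$ are absolutely continuous with respect to Lebesgue measure), or both of the inequalities above are strict. -/

import Mathlib

open MeasureTheory
open scoped ENNReal

/-- `γ` is a coupling of `μ` and `ν`: its two marginals are `μ` and `ν`. -/
structure IsCoupling {X : Type*} [MeasurableSpace X]
    (γ : Measure (X × X)) (μ ν : Measure X) : Prop where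
  fst : γ.map Prod.fst = μ
  snd : γ.map Prod.snd = ν

/-- The Wasserstein-1 distance: the infimum of `∫ ‖x - y‖ dγ` over all couplings `γ`. -/
noncomputable def wasserstein1 {X : Type*} [MeasurableSpace X] [PseudoEMetricSpace X]
    (μ ν : Measure X) : ℝ≥0∞ :=
  ⨅ (γ : Measure (X × X)) (_ : IsCoupling γ μ ν), ∫⁻ z, edist z.1 z.2 ∂γ

/-- The mixture `p μ₁ + (1 - p) μ₂`, used for `p ∈ [0, 1]`. -/
noncomputable def mixture {X : Type*} [MeasurableSpace X]
    (p : ℝ) (μ₁ μ₂ : Measure X) : Measure X :=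
  ENNReal.ofReal p • μ₁ + ENNReal.ofReal (1 - p) • μ₂

/-- The distance `inf {dist x y : x ∈ A, y ∈ B}` between two (nonempty) sets. -/
noncomputable def setDist {X : Type*} [PseudoMetricSpace X] (A B : Set X) : ℝ :=
  sInf (Set.image2 dist A B)

/-- The diameter of the support of a (boundedly supported) measure. -/
noncomputable def supportDiam {X : Type*} [MeasurableSpace X] [PseudoMetricSpace X]
    (μ : Measure X) : ℝ :=
  Metric.diam μ.support

/-- The distance between the supports of two measures. -/
noncomputable def supportDist {X : Type*} [MeasurableSpace X] [PseudoMetricSpace X]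
    (μ ν : Measure X) : ℝ :=
  setDist μ.support ν.support

/-- The set of all minimizers of `f` over `S`. -/
def argminOn {α β : Type*} [Preorder β] (f : α → β) (S : Set α) : Set α :=
  {x | x ∈ S ∧ ∀ y ∈ S, f x ≤ f y}

/-! Fix the first marginal at weight `q` and raise the weight of the second from `q` to `p`. Any
coupling `γ` must then send some mass `m₂₁ ≥ p - q` from the support of `μ₂` to that of `ν₁`, at
unit cost at least `L₂`. Repair `γ` into a coupling for the weight `q`: keep the fraction `k = q /
p` of its `A₁ ×ˢ B₁` part, keep all of its `A₂ ×ˢ B₂` part, and fill up inside these two blocks. The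
fillings have masses `k * m₂₁` and `m₂₁`, with unit costs at most `D₁` and `D₂`. The mass balance
shows that the repair saves at least `m₂₁ * (L₂ - D₂ - k * (D₁ - l))`; this is
`wasserstein1_mixture_add_le`.

With `Dᵢ` equal to the distance of the supports plus their diameters, separation makes the bracket
at least `1 - k` times the diameters of `μ₁` and `ν₁`, plus any slack in the inequality for `L₂`.
Weights below `q` follow by exchanging the indices. -/

section Coupling

variable {X : Type*} [MeasurableSpace X]

/-! ### Constructing couplings. -/

/-- The product measure divided by the common mass is such a coupling. -/
theorem exists_isCoupling_of_univ_eq [PseudoMetricSpace X] {α β : Measure X}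
    [IsFiniteMeasure α] [IsFiniteMeasure β] (h : α Set.univ = β Set.univ) {A B : Set X}
    (hA : α Aᶜ = 0) (hB : β Bᶜ = 0) {D : ℝ} (hD : ∀ x ∈ A, ∀ y ∈ B, dist x y ≤ D) :
    ∃ γ, IsCoupling γ α β ∧ ∫⁻ z, edist z.1 z.2 ∂γ ≤ α Set.univ * ENNReal.ofReal D := by
  by_cases h0 : α Set.univ = 0
  · have hα : α = 0 := Measure.measure_univ_eq_zero.1 h0
    have hβ : β = 0 := Measure.measure_univ_eq_zero.1 (h ▸ h0)
    subst hα hβ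
    exact ⟨0, ⟨by simp, by simp⟩, by simp⟩
  have ht : α Set.univ ≠ ⊤ := measure_ne_top _ _
  have hcost : ∫⁻ z, edist z.1 z.2 ∂(α.prod β) ≤ α Set.univ * α Set.univ * ENNReal.ofReal D := by
    have hae : ∀ᵐ z ∂(α.prod β), edist z.1 z.2 ≤ ENNReal.ofReal D := by
      have h1 : ∀ᵐ z ∂(α.prod β), z.1 ∈ A :=
        Measure.quasiMeasurePreserving_fst.ae (p := fun x => x ∈ A) hA
      have h2 : ∀ᵐ z ∂(α.prod β), z.2 ∈ B :=
        Measure.quasiMeasurePreserving_snd.ae (p := fun x => x ∈ B) hB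
      filter_upwards [h1, h2] with z hz1 hz2
      rw [edist_dist]
      exact ENNReal.ofReal_le_ofReal (hD _ hz1 _ hz2)
    calc ∫⁻ z, edist z.1 z.2 ∂(α.prod β) ≤ ∫⁻ _, ENNReal.ofReal D ∂(α.prod β) :=
          lintegral_mono_ae hae
      _ = α Set.univ * α Set.univ * ENNReal.ofReal D := by
          rw [lintegral_const, ← Set.univ_prod_univ, Measure.prod_prod, ← h, mul_comm]
  refine ⟨(α Set.univ)⁻¹ • α.prod β, ⟨?_, ?_⟩, ?_⟩
  · rw [Measure.map_smul, Measure.map_fst_prod, ← h, smul_smul, ENNReal.inv_mul_cancel h0 ht,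
      one_smul]
  · rw [Measure.map_smul, Measure.map_snd_prod, smul_smul, ENNReal.inv_mul_cancel h0 ht, one_smul]
  · rw [lintegral_smul_measure, smul_eq_mul]
    calc _ ≤ (α Set.univ)⁻¹ * (α Set.univ * α Set.univ * ENNReal.ofReal D) := by gcongr
      _ = α Set.univ * ENNReal.ofReal D := by
        rw [mul_assoc, ← mul_assoc, ENNReal.inv_mul_cancel h0 ht, one_mul]

theorem IsCoupling.add {γ γ' : Measure (X × X)} {α β α' β' : Measure X}
    (h : IsCoupling γ α β) (h' : IsCoupling γ' α' β') :
    IsCoupling (γ + γ') (α + α') (β + β') :=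
  ⟨by rw [Measure.map_add _ _ measurable_fst, h.fst, h'.fst],
   by rw [Measure.map_add _ _ measurable_snd, h.snd, h'.snd]⟩

/-- A transport plan with marginals below `α` and `β` extends to a coupling, at a cost bounded by
the missing mass times the largest distance. -/
theorem exists_isCoupling_extending [PseudoMetricSpace X] {α β : Measure X}
    [IsFiniteMeasure α] [IsFiniteMeasure β] (h : α Set.univ = β Set.univ) {A B : Set X}
    (hA : α Aᶜ = 0) (hB : β Bᶜ = 0) {D : ℝ} (hD : ∀ x ∈ A, ∀ y ∈ B, dist x y ≤ D)
    {η : Measure (X × X)} (h₁ : η.map Prod.fst ≤ α) (h₂ : η.map Prod.snd ≤ β) :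
    ∃ γ, IsCoupling γ α β ∧ ∫⁻ z, edist z.1 z.2 ∂γ ≤
      ∫⁻ z, edist z.1 z.2 ∂η + (α Set.univ - η Set.univ) * ENNReal.ofReal D := by
  have : IsFiniteMeasure (η.map Prod.fst) := isFiniteMeasure_of_le α h₁
  have : IsFiniteMeasure (η.map Prod.snd) := isFiniteMeasure_of_le β h₂
  have u₁ : (α - η.map Prod.fst) Set.univ = α Set.univ - η Set.univ := by
    rw [Measure.sub_apply .univ h₁, Measure.map_apply measurable_fst .univ, Set.preimage_univ]
  have u₂ : (β - η.map Prod.snd) Set.univ = α Set.univ - η Set.univ := by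
    rw [Measure.sub_apply .univ h₂, Measure.map_apply measurable_snd .univ, Set.preimage_univ, h]
  -- Both marginals miss the same amount of mass, so the remainders can be coupled with each other.
  obtain ⟨γ, hγ, hc⟩ := exists_isCoupling_of_univ_eq (u₁.trans u₂.symm)
    (le_antisymm ((Measure.sub_le _).trans hA.le) zero_le)
    (le_antisymm ((Measure.sub_le _).trans hB.le) zero_le) hD
  refine ⟨η + γ, ?_, ?_⟩
  · have := IsCoupling.add (γ := η) ⟨rfl, rfl⟩ hγ
    rwa [add_comm _ (α - _), Measure.sub_add_cancel_of_le h₁, add_comm _ (β - _),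
      Measure.sub_add_cancel_of_le h₂] at this
  · rw [lintegral_add_measure, ← u₁]
    gcongr

/-! ### Splitting a coupling into blocks. -/

/-- Since `β` does not charge `A`, all mass of `γ` above `A` comes from `α`. -/
theorem map_fst_restrict_le {γ : Measure (X × X)} {α β : Measure X} {A B : Set X}
    (h : γ.map Prod.fst = α + β) (hA : MeasurableSet A) (hβ : β A = 0) :
    (γ.restrict (A ×ˢ B)).map Prod.fst ≤ α := by
  refine Measure.le_iff.2 fun s hs => ?_
  rw [Measure.map_apply measurable_fst hs, Measure.restrict_apply (measurable_fst hs)]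
  calc γ (Prod.fst ⁻¹' s ∩ A ×ˢ B) ≤ γ (Prod.fst ⁻¹' (s ∩ A)) :=
        measure_mono fun z hz => ⟨hz.1, hz.2.1⟩
    _ = α (s ∩ A) + β (s ∩ A) := by
        rw [← Measure.map_apply measurable_fst (hs.inter hA), h, Measure.add_apply]
    _ ≤ α s := by
        rw [measure_mono_null Set.inter_subset_right hβ, add_zero]
        exact measure_mono Set.inter_subset_left

theorem map_snd_restrict_le {γ : Measure (X × X)} {α β : Measure X} {A B : Set X}
    (h : γ.map Prod.snd = α + β) (hB : MeasurableSet B) (hβ : β B = 0) :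
    (γ.restrict (A ×ˢ B)).map Prod.snd ≤ α := by
  refine Measure.le_iff.2 fun s hs => ?_
  rw [Measure.map_apply measurable_snd hs, Measure.restrict_apply (measurable_snd hs)]
  calc γ (Prod.snd ⁻¹' s ∩ A ×ˢ B) ≤ γ (Prod.snd ⁻¹' (s ∩ B)) :=
        measure_mono fun z hz => ⟨hz.1, hz.2.2⟩
    _ = α (s ∩ B) + β (s ∩ B) := by
        rw [← Measure.map_apply measurable_snd (hs.inter hB), h, Measure.add_apply]
    _ ≤ α s := by
        rw [measure_mono_null Set.inter_subset_right hβ, add_zero]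
        exact measure_mono Set.inter_subset_left

theorem measure_prod_add_of_map_fst {γ : Measure (X × X)} {α ν₁ ν₂ : Measure X} {A B₁ B₂ : Set X}
    (h : γ.map Prod.fst = α) (h' : γ.map Prod.snd = ν₁ + ν₂) (hA : MeasurableSet A)
    (hB₁ : MeasurableSet B₁) (hB₂ : MeasurableSet B₂) (hB : Disjoint B₁ B₂)
    (hν₁ : ν₁ B₁ᶜ = 0) (hν₂ : ν₂ B₂ᶜ = 0) :
    γ (A ×ˢ B₁) + γ (A ×ˢ B₂) = α A := by
  have hU : γ (Prod.snd ⁻¹' (B₁ ∪ B₂)ᶜ) = 0 := by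
    rw [← Measure.map_apply measurable_snd (hB₁.union hB₂).compl, h', Measure.add_apply,
      measure_mono_null (Set.compl_subset_compl.2 Set.subset_union_left) hν₁,
      measure_mono_null (Set.compl_subset_compl.2 Set.subset_union_right) hν₂, add_zero]
  rw [← measure_union (Set.disjoint_prod.2 (Or.inr hB)) (hA.prod hB₂), ← Set.prod_union, ← h,
    Measure.map_apply measurable_fst hA]
  refine le_antisymm (measure_mono fun z hz => hz.1) ?_
  calc γ (Prod.fst ⁻¹' A) ≤ γ (A ×ˢ (B₁ ∪ B₂) ∪ Prod.snd ⁻¹' (B₁ ∪ B₂)ᶜ) :=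
        measure_mono fun z hz => (em (z.2 ∈ B₁ ∪ B₂)).imp (fun h => ⟨hz, h⟩) id
    _ ≤ γ (A ×ˢ (B₁ ∪ B₂)) + 0 := hU ▸ measure_union_le _ _
    _ = _ := add_zero _

theorem IsCoupling.swap {γ : Measure (X × X)} {α β : Measure X} (h : IsCoupling γ α β) :
    IsCoupling (γ.map Prod.swap) β α :=
  ⟨by rw [Measure.map_map measurable_fst measurable_swap]; exact h.snd,
   by rw [Measure.map_map measurable_snd measurable_swap]; exact h.fst⟩

theorem measure_prod_add_of_map_snd {γ : Measure (X × X)} {α μ₁ μ₂ : Measure X} {B A₁ A₂ : Set X}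
    (h : γ.map Prod.snd = α) (h' : γ.map Prod.fst = μ₁ + μ₂) (hB : MeasurableSet B)
    (hA₁ : MeasurableSet A₁) (hA₂ : MeasurableSet A₂) (hA : Disjoint A₁ A₂)
    (hμ₁ : μ₁ A₁ᶜ = 0) (hμ₂ : μ₂ A₂ᶜ = 0) :
    γ (A₁ ×ˢ B) + γ (A₂ ×ˢ B) = α B := by
  have hs := IsCoupling.swap (γ := γ) ⟨h', h⟩
  have := measure_prod_add_of_map_fst hs.fst hs.snd hB hA₁ hA₂ hA hμ₁ hμ₂
  rwa [Measure.map_apply measurable_swap (hB.prod hA₁),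
    Measure.map_apply measurable_swap (hB.prod hA₂), Set.preimage_swap_prod,
    Set.preimage_swap_prod] at this

theorem mul_measure_le_setLIntegral_edist [PseudoMetricSpace X] (γ : Measure (X × X))
    {A B : Set X} (hA : MeasurableSet A) (hB : MeasurableSet B) {l : ℝ}
    (hl : ∀ x ∈ A, ∀ y ∈ B, l ≤ dist x y) :
    ENNReal.ofReal l * γ (A ×ˢ B) ≤ ∫⁻ z in A ×ˢ B, edist z.1 z.2 ∂γ := by
  rw [← setLIntegral_const]
  refine setLIntegral_mono' (hA.prod hB) fun z hz => ?_
  rw [edist_dist]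
  exact ENNReal.ofReal_le_ofReal (hl _ hz.1 _ hz.2)

theorem four_setLIntegral_le (γ : Measure (X × X)) (f : X × X → ℝ≥0∞) {A₁ A₂ B₁ B₂ : Set X}
    (hA₁ : MeasurableSet A₁) (hA₂ : MeasurableSet A₂)
    (hB₁ : MeasurableSet B₁) (hB₂ : MeasurableSet B₂)
    (hA : Disjoint A₁ A₂) (hB : Disjoint B₁ B₂) :
    ∫⁻ z in A₁ ×ˢ B₁, f z ∂γ + ∫⁻ z in A₁ ×ˢ B₂, f z ∂γ +
      (∫⁻ z in A₂ ×ˢ B₁, f z ∂γ + ∫⁻ z in A₂ ×ˢ B₂, f z ∂γ) ≤ ∫⁻ z, f z ∂γ := by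
  rw [← lintegral_union (hA₁.prod hB₂) (Set.disjoint_prod.2 (Or.inr hB)),
    ← lintegral_union (hA₂.prod hB₂) (Set.disjoint_prod.2 (Or.inr hB)),
    ← Set.prod_union, ← Set.prod_union,
    ← lintegral_union (hA₂.prod (hB₁.union hB₂)) (Set.disjoint_prod.2 (Or.inl hA))]
  exact setLIntegral_le_lintegral _ _

/-! ### The cost of shifting the weight. -/

/-- Moving the mixture weight from `q` up to `p` increases the cost linearly. -/
theorem wasserstein1_mixture_add_le [PseudoMetricSpace X] {μ₁ μ₂ ν₁ ν₂ : Measure X}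
    [IsProbabilityMeasure μ₁] [IsProbabilityMeasure μ₂]
    [IsProbabilityMeasure ν₁] [IsProbabilityMeasure ν₂] {A₁ A₂ B₁ B₂ : Set X}
    (hA₁ : MeasurableSet A₁) (hA₂ : MeasurableSet A₂)
    (hB₁ : MeasurableSet B₁) (hB₂ : MeasurableSet B₂)
    (hA : Disjoint A₁ A₂) (hB : Disjoint B₁ B₂)
    (hμ₁ : μ₁ A₁ᶜ = 0) (hμ₂ : μ₂ A₂ᶜ = 0) (hν₁ : ν₁ B₁ᶜ = 0) (hν₂ : ν₂ B₂ᶜ = 0)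
    {l D₁ D₂ L₁ L₂ : ℝ} (hl : 0 ≤ l) (hlL : l ≤ L₁) (hL₂ : 0 ≤ L₂) (hD₁ : 0 ≤ D₁) (hD₂ : 0 ≤ D₂)
    (h₁₁ : ∀ x ∈ A₁, ∀ y ∈ B₁, l ≤ dist x y) (h₁₁' : ∀ x ∈ A₁, ∀ y ∈ B₁, dist x y ≤ D₁)
    (h₂₂ : ∀ x ∈ A₂, ∀ y ∈ B₂, dist x y ≤ D₂)
    (h₁₂ : ∀ x ∈ A₁, ∀ y ∈ B₂, L₁ ≤ dist x y) (h₂₁ : ∀ x ∈ A₂, ∀ y ∈ B₁, L₂ ≤ dist x y)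
    {q p : ℝ} (hq : 0 < q) (hqp : q ≤ p)
    (hgap : 0 ≤ L₂ - D₂ - q / p * (D₁ - l)) :
    wasserstein1 (mixture q μ₁ μ₂) (mixture q ν₁ ν₂) +
        ENNReal.ofReal ((p - q) * (L₂ - D₂ - q / p * (D₁ - l))) ≤
      wasserstein1 (mixture q μ₁ μ₂) (mixture p ν₁ ν₂) := by
  have hp0 : 0 < p := hq.trans_le hqp
  refine le_iInf₂ fun γ hγ => ?_
  by_cases htop : ∫⁻ z, edist z.1 z.2 ∂γ = ⊤
  · rw [htop]; exact le_top
  have hγ₁ : γ.map Prod.fst = ENNReal.ofReal q • μ₁ + ENNReal.ofReal (1 - q) • μ₂ := hγ.fst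
  have hγ₂ : γ.map Prod.snd = ENNReal.ofReal p • ν₁ + ENNReal.ofReal (1 - p) • ν₂ := hγ.snd
  have nμ₁ : μ₁ A₂ = 0 := measure_mono_null hA.subset_compl_left hμ₁
  have nμ₂ : μ₂ A₁ = 0 := measure_mono_null hA.subset_compl_right hμ₂
  have nν₁ : ν₁ B₂ = 0 := measure_mono_null hB.subset_compl_left hν₁
  have nν₂ : ν₂ B₁ = 0 := measure_mono_null hB.subset_compl_right hν₂
  have oμ₁ : μ₁ A₁ = 1 := (prob_compl_eq_zero_iff hA₁).1 hμ₁
  have oμ₂ : μ₂ A₂ = 1 := (prob_compl_eq_zero_iff hA₂).1 hμ₂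
  have oν₁ : ν₁ B₁ = 1 := (prob_compl_eq_zero_iff hB₁).1 hν₁
  have s₁ : γ (A₁ ×ˢ B₁) + γ (A₁ ×ˢ B₂) = ENNReal.ofReal q := by
    rw [measure_prod_add_of_map_fst hγ₁ hγ₂ hA₁ hB₁ hB₂ hB (by simp [hν₁]) (by simp [hν₂])]
    simp [oμ₁, nμ₂]
  have s₂ : γ (A₂ ×ˢ B₁) + γ (A₂ ×ˢ B₂) = ENNReal.ofReal (1 - q) := by
    rw [measure_prod_add_of_map_fst hγ₁ hγ₂ hA₂ hB₁ hB₂ hB (by simp [hν₁]) (by simp [hν₂])]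
    simp [oμ₂, nμ₁]
  have s₃ : γ (A₁ ×ˢ B₁) + γ (A₂ ×ˢ B₁) = ENNReal.ofReal p := by
    rw [measure_prod_add_of_map_snd hγ₂ hγ₁ hB₁ hA₁ hA₂ hA (by simp [hμ₁]) (by simp [hμ₂])]
    simp [oν₁, nν₂]
  have hkq : ENNReal.ofReal (q / p) * ENNReal.ofReal p = ENNReal.ofReal q := by
    rw [← ENNReal.ofReal_mul (by positivity), div_mul_cancel₀ _ hp0.ne']
  have hk1 : ENNReal.ofReal (q / p) ≤ 1 :=
    ENNReal.ofReal_le_one.2 ((div_le_one hp0).2 hqp)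
  have fin₁ : IsFiniteMeasure (ENNReal.ofReal q • μ₁) := Measure.smul_finite _ (by simp)
  have fin₂ : IsFiniteMeasure (ENNReal.ofReal (1 - q) • μ₂) := Measure.smul_finite _ (by simp)
  have fin₃ : IsFiniteMeasure (ENNReal.ofReal q • ν₁) := Measure.smul_finite _ (by simp)
  have fin₄ : IsFiniteMeasure (ENNReal.ofReal (1 - q) • ν₂) := Measure.smul_finite _ (by simp)
  -- The second marginal of the first block is at most `p ν₁`; the factor `q / p` brings it below `q
  -- ν₁`.
  obtain ⟨γ₁, hc₁, hγ₁c⟩ := exists_isCoupling_extending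
    (α := ENNReal.ofReal q • μ₁) (β := ENNReal.ofReal q • ν₁) (by simp) (by simp [hμ₁])
    (by simp [hν₁]) h₁₁' (η := ENNReal.ofReal (q / p) • γ.restrict (A₁ ×ˢ B₁))
    (by
      rw [Measure.map_smul]
      calc _ ≤ (1 : ℝ≥0∞) • (γ.restrict (A₁ ×ˢ B₁)).map Prod.fst := by gcongr
        _ ≤ _ := by
          rw [one_smul]
          exact map_fst_restrict_le hγ₁ hA₁ (by simp [nμ₂]))
    (by
      rw [Measure.map_smul, ← hkq, mul_smul]
      gcongr
      exact map_snd_restrict_le hγ₂ hB₁ (by simp [nν₂]))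
  -- No scaling is needed here, since `1 - p ≤ 1 - q`.
  obtain ⟨γ₂, hc₂, hγ₂c⟩ := exists_isCoupling_extending
    (α := ENNReal.ofReal (1 - q) • μ₂) (β := ENNReal.ofReal (1 - q) • ν₂) (by simp)
    (by simp [hμ₂]) (by simp [hν₂]) h₂₂ (η := γ.restrict (A₂ ×ˢ B₂))
    (map_fst_restrict_le (by rw [hγ₁, add_comm]) hA₂ (by simp [nμ₁]))
    (by
      refine (map_snd_restrict_le (α := ENNReal.ofReal (1 - p) • ν₂)
        (by rw [hγ₂, add_comm]) hB₂ (by simp [nν₁])).trans ?_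
      gcongr)
  have hW : wasserstein1 (mixture q μ₁ μ₂) (mixture q ν₁ ν₂) ≤ _ :=
    (iInf₂_le (γ₁ + γ₂) (hc₁.add hc₂)).trans
      ((lintegral_add_measure _ _ _).trans_le (add_le_add hγ₁c hγ₂c))
  refine (add_le_add_left hW _).trans ?_
  have b₁₁ := mul_measure_le_setLIntegral_edist γ hA₁ hB₁ h₁₁
  have b₁₂ := mul_measure_le_setLIntegral_edist γ hA₁ hB₂ h₁₂
  have b₂₁ := mul_measure_le_setLIntegral_edist γ hA₂ hB₁ h₂₁
  have htot := four_setLIntegral_le γ (fun z => edist z.1 z.2) hA₁ hA₂ hB₁ hB₂ hA hB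
  refine le_trans ?_ htot
  have hlt := htot.trans_lt (lt_top_iff_ne_top.2 htop)
  simp only [lintegral_smul_measure, Measure.smul_apply, Measure.restrict_apply_univ,
    smul_eq_mul, measure_univ, mul_one]
  generalize γ (A₁ ×ˢ B₁) = m₁₁ at *
  generalize γ (A₁ ×ˢ B₂) = m₁₂ at *
  generalize γ (A₂ ×ˢ B₁) = m₂₁ at *
  generalize γ (A₂ ×ˢ B₂) = m₂₂ at *
  generalize ∫⁻ z in A₁ ×ˢ B₁, edist z.1 z.2 ∂γ = c₁₁ at *
  generalize ∫⁻ z in A₁ ×ˢ B₂, edist z.1 z.2 ∂γ = c₁₂ at *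
  generalize ∫⁻ z in A₂ ×ˢ B₁, edist z.1 z.2 ∂γ = c₂₁ at *
  generalize ∫⁻ z in A₂ ×ˢ B₂, edist z.1 z.2 ∂γ = c₂₂ at *
  simp only [ENNReal.add_lt_top] at hlt
  obtain ⟨⟨t₁₁, t₁₂⟩, t₂₁, t₂₂⟩ := hlt
  have u₁ : m₁₁ < ⊤ ∧ m₁₂ < ⊤ := ENNReal.add_lt_top.1 (s₁ ▸ ENNReal.ofReal_lt_top)
  have u₂ : m₂₁ < ⊤ ∧ m₂₂ < ⊤ := ENNReal.add_lt_top.1 (s₂ ▸ ENNReal.ofReal_lt_top)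
  obtain ⟨u₁₁, u₁₂⟩ := u₁
  obtain ⟨u₂₁, u₂₂⟩ := u₂
  -- The masses missing from the two blocks, both expressed through `m₂₁`.
  have e₁ : ENNReal.ofReal q - ENNReal.ofReal (q / p) * m₁₁ = ENNReal.ofReal (q / p) * m₂₁ := by
    rw [← hkq, ← s₃, mul_add]
    exact ENNReal.add_sub_cancel_left (ENNReal.mul_ne_top ENNReal.ofReal_ne_top u₁₁.ne)
  have e₂ : ENNReal.ofReal (1 - q) - m₂₂ = m₂₁ := by
    rw [← s₂]; exact ENNReal.add_sub_cancel_right u₂₂.ne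
  rw [e₁, e₂]
  clear e₁ e₂ hkq hk1 hW hγ₁c hγ₂c htot
  lift m₁₁ to NNReal using u₁₁.ne
  lift m₁₂ to NNReal using u₁₂.ne
  lift m₂₁ to NNReal using u₂₁.ne
  lift m₂₂ to NNReal using u₂₂.ne
  lift c₁₁ to NNReal using t₁₁.ne
  lift c₁₂ to NNReal using t₁₂.ne
  lift c₂₁ to NNReal using t₂₁.ne
  lift c₂₂ to NNReal using t₂₂.ne
  have hk0 : 0 ≤ q / p := by positivity
  have hk1 : q / p ≤ 1 := (div_le_one hp0).2 hqp
  have hkq : q / p * p = q := div_mul_cancel₀ _ hp0.ne'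
  have hg : 0 ≤ (p - q) * (L₂ - D₂ - q / p * (D₁ - l)) := mul_nonneg (by linarith) hgap
  simp only [← ENNReal.ofReal_coe_nnreal] at *
  have hL₁ : 0 ≤ L₁ := hl.trans hlL
  rw [← ENNReal.ofReal_add (by positivity) (by positivity), ENNReal.ofReal_eq_ofReal_iff
    (by positivity) (by linarith)] at s₁ s₃
  rw [← ENNReal.ofReal_mul (by assumption), ENNReal.ofReal_le_ofReal_iff (by positivity)]
    at b₁₁ b₁₂ b₂₁
  rw [← ENNReal.ofReal_mul hk0, ← ENNReal.ofReal_mul hk0, ← ENNReal.ofReal_mul (by positivity),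
    ← ENNReal.ofReal_mul (by positivity), ← ENNReal.ofReal_add (by positivity) (by positivity),
    ← ENNReal.ofReal_add (by positivity) (by positivity),
    ← ENNReal.ofReal_add (by positivity) (by positivity),
    ← ENNReal.ofReal_add (by positivity) hg,
    ← ENNReal.ofReal_add (by positivity) (by positivity),
    ← ENNReal.ofReal_add (by positivity) (by positivity),
    ← ENNReal.ofReal_add (by positivity) (by positivity)]
  apply ENNReal.ofReal_le_ofReal
  generalize q / p = k at *
  have n₁₂ : (0 : ℝ) ≤ m₁₂ := m₁₂.2
  have f₁ := mul_le_mul_of_nonneg_left b₁₁ (sub_nonneg.2 hk1)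
  have f₂ := mul_le_mul_of_nonneg_right hlL n₁₂
  have f₃ : (p - q) * (L₂ - D₂ - k * (D₁ - l)) ≤ m₂₁ * (L₂ - D₂ - k * (D₁ - l)) :=
    mul_le_mul_of_nonneg_right (by linarith) hgap
  -- Both sides are `l * q`; this trades the unknown `m₁₂` for `m₂₁`.
  have f₄ : l * (m₁₁ + m₁₂) = l * (k * (m₁₁ + m₂₁)) := by rw [s₁, s₃, hkq]
  linarith

theorem mixture_one_sub (p : ℝ) (μ₁ μ₂ : Measure X) :
    mixture (1 - p) μ₂ μ₁ = mixture p μ₁ μ₂ := by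
  rw [mixture, mixture, sub_sub_cancel, add_comm]

/-- Strict growth in `ℝ≥0∞` requires a finite starting value. -/
theorem wasserstein1_mixture_self_ne_top [PseudoMetricSpace X] {μ₁ μ₂ ν₁ ν₂ : Measure X}
    [IsProbabilityMeasure μ₁] [IsProbabilityMeasure μ₂]
    [IsProbabilityMeasure ν₁] [IsProbabilityMeasure ν₂] {A₁ A₂ B₁ B₂ : Set X}
    (hμ₁ : μ₁ A₁ᶜ = 0) (hμ₂ : μ₂ A₂ᶜ = 0) (hν₁ : ν₁ B₁ᶜ = 0) (hν₂ : ν₂ B₂ᶜ = 0)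
    {D₁ D₂ : ℝ} (h₁ : ∀ x ∈ A₁, ∀ y ∈ B₁, dist x y ≤ D₁)
    (h₂ : ∀ x ∈ A₂, ∀ y ∈ B₂, dist x y ≤ D₂) (q : ℝ) :
    wasserstein1 (mixture q μ₁ μ₂) (mixture q ν₁ ν₂) ≠ ⊤ := by
  have fin₁ : IsFiniteMeasure (ENNReal.ofReal q • μ₁) := Measure.smul_finite _ (by simp)
  have fin₂ : IsFiniteMeasure (ENNReal.ofReal (1 - q) • μ₂) := Measure.smul_finite _ (by simp)
  have fin₃ : IsFiniteMeasure (ENNReal.ofReal q • ν₁) := Measure.smul_finite _ (by simp)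
  have fin₄ : IsFiniteMeasure (ENNReal.ofReal (1 - q) • ν₂) := Measure.smul_finite _ (by simp)
  obtain ⟨γ₁, hc₁, hγ₁⟩ := exists_isCoupling_of_univ_eq (α := ENNReal.ofReal q • μ₁)
    (β := ENNReal.ofReal q • ν₁) (by simp) (by simp [hμ₁]) (by simp [hν₁]) h₁
  obtain ⟨γ₂, hc₂, hγ₂⟩ := exists_isCoupling_of_univ_eq (α := ENNReal.ofReal (1 - q) • μ₂)
    (β := ENNReal.ofReal (1 - q) • ν₂) (by simp) (by simp [hμ₂]) (by simp [hν₂]) h₂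
  refine ne_top_of_le_ne_top ?_ ((iInf₂_le (γ₁ + γ₂) (hc₁.add hc₂)).trans
      ((lintegral_add_measure _ _ _).trans_le (add_le_add hγ₁ hγ₂)))
  simp [ENNReal.mul_eq_top]

end Coupling

/-! ### Distances and diameters of supports. -/

section Supports

variable {X : Type*} [PseudoMetricSpace X]

theorem setDist_le_dist {A B : Set X} {x y : X} (hx : x ∈ A) (hy : y ∈ B) :
    setDist A B ≤ dist x y := by
  refine csInf_le ⟨0, ?_⟩ (Set.mem_image2_of_mem hx hy)
  rintro _ ⟨a, -, b, -, rfl⟩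
  exact dist_nonneg

theorem setDist_nonneg (A B : Set X) : 0 ≤ setDist A B := by
  refine Real.sInf_nonneg ?_
  rintro _ ⟨a, -, b, -, rfl⟩
  exact dist_nonneg

theorem dist_le_setDist_add_diam {A B : Set X} (hA : Bornology.IsBounded A)
    (hB : Bornology.IsBounded B) {x y : X} (hx : x ∈ A) (hy : y ∈ B) :
    dist x y ≤ setDist A B + Metric.diam A + Metric.diam B := by
  have : dist x y - Metric.diam A - Metric.diam B ≤ setDist A B := by
    refine le_csInf ⟨_, Set.mem_image2_of_mem hx hy⟩ ?_
    rintro _ ⟨a, ha, b, hb, rfl⟩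
    have h₁ := dist_triangle4 x a b y
    have h₂ := Metric.dist_le_diam_of_mem hA hx ha
    have h₃ := Metric.dist_le_diam_of_mem hB hb hy
    linarith
  linarith

variable [MeasurableSpace X] [OpensMeasurableSpace X] [HereditarilyLindelofSpace X]

/-- Increasing the mixture weight from `q` to `p` does not decrease the cost; it strictly
increases it if a support is not a single point or the separation is strict. -/
theorem wasserstein1_mixture_increase {μ₁ μ₂ ν₁ ν₂ : Measure X}
    [IsProbabilityMeasure μ₁] [IsProbabilityMeasure μ₂]
    [IsProbabilityMeasure ν₁] [IsProbabilityMeasure ν₂]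
    (hμ₁ : Bornology.IsBounded μ₁.support) (hμ₂ : Bornology.IsBounded μ₂.support)
    (hν₁ : Bornology.IsBounded ν₁.support) (hν₂ : Bornology.IsBounded ν₂.support)
    (hμ : Disjoint μ₁.support μ₂.support) (hν : Disjoint ν₁.support ν₂.support)
    (hL₁ : supportDist μ₁ ν₁ +
        supportDiam ν₁ + supportDiam ν₂ + supportDiam μ₁ + supportDiam μ₂ ≤ supportDist μ₁ ν₂)
    (hL₂ : supportDist μ₂ ν₂ +
        supportDiam ν₁ + supportDiam ν₂ + supportDiam μ₁ + supportDiam μ₂ ≤ supportDist μ₂ ν₁)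
    {q p : ℝ} (hq : 0 < q) (hqp : q < p) :
    wasserstein1 (mixture q μ₁ μ₂) (mixture q ν₁ ν₂) ≤
        wasserstein1 (mixture q μ₁ μ₂) (mixture p ν₁ ν₂) ∧
      ((0 < supportDiam μ₁ ∨ 0 < supportDiam ν₁) ∨ supportDist μ₂ ν₂ + supportDiam ν₁ +
          supportDiam ν₂ + supportDiam μ₁ + supportDiam μ₂ < supportDist μ₂ ν₁ →
        wasserstein1 (mixture q μ₁ μ₂) (mixture q ν₁ ν₂) <
          wasserstein1 (mixture q μ₁ μ₂) (mixture p ν₁ ν₂)) := by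
  have d₁ : 0 ≤ supportDiam μ₁ := Metric.diam_nonneg
  have d₂ : 0 ≤ supportDiam μ₂ := Metric.diam_nonneg
  have d₃ : 0 ≤ supportDiam ν₁ := Metric.diam_nonneg
  have d₄ : 0 ≤ supportDiam ν₂ := Metric.diam_nonneg
  have l₁ : 0 ≤ supportDist μ₁ ν₁ := setDist_nonneg _ _
  have l₂ : 0 ≤ supportDist μ₂ ν₂ := setDist_nonneg _ _
  have hp0 : 0 < p := hq.trans hqp
  have hk0 : 0 ≤ q / p := by positivity
  have hk1 : q / p < 1 := (div_lt_one hp0).2 hqp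
  have b₁ : ∀ x ∈ μ₁.support, ∀ y ∈ ν₁.support,
      dist x y ≤ supportDist μ₁ ν₁ + supportDiam μ₁ + supportDiam ν₁ :=
    fun x hx y hy => dist_le_setDist_add_diam hμ₁ hν₁ hx hy
  have b₂ : ∀ x ∈ μ₂.support, ∀ y ∈ ν₂.support,
      dist x y ≤ supportDist μ₂ ν₂ + supportDiam μ₂ + supportDiam ν₂ :=
    fun x hx y hy => dist_le_setDist_add_diam hμ₂ hν₂ hx hy
  -- A lower bound for the gap: `D₁ - l` is this sum of diameters, and by `hL₂` so much at least is
  -- left in `L₂ - D₂`.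
  have hprod : 0 ≤ (1 - q / p) * (supportDiam μ₁ + supportDiam ν₁) :=
    mul_nonneg (by linarith) (by linarith)
  have key := wasserstein1_mixture_add_le (μ₁ := μ₁) (μ₂ := μ₂) (ν₁ := ν₁) (ν₂ := ν₂)
    Measure.isClosed_support.measurableSet Measure.isClosed_support.measurableSet
    Measure.isClosed_support.measurableSet Measure.isClosed_support.measurableSet hμ hν
    Measure.measure_compl_support Measure.measure_compl_support
    Measure.measure_compl_support Measure.measure_compl_support
    (L₁ := supportDist μ₁ ν₂) (L₂ := supportDist μ₂ ν₁)
    l₁ (by linarith) (setDist_nonneg _ _) (by positivity) (by positivity)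
    (fun x hx y hy => setDist_le_dist hx hy) b₁ b₂
    (fun x hx y hy => setDist_le_dist hx hy) (fun x hx y hy => setDist_le_dist hx hy)
    hq hqp.le (by linarith)
  refine ⟨le_self_add.trans key, fun hs => lt_of_lt_of_le (ENNReal.lt_add_right ?_ ?_) key⟩
  · exact wasserstein1_mixture_self_ne_top Measure.measure_compl_support
      Measure.measure_compl_support Measure.measure_compl_support Measure.measure_compl_support
      b₁ b₂ q
  · refine (ENNReal.ofReal_pos.2 (mul_pos (sub_pos.2 hqp) ?_)).ne'
    rcases hs with hs | hs
    · have : 0 < (1 - q / p) * (supportDiam μ₁ + supportDiam ν₁) :=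
        mul_pos (by linarith) (by rcases hs with hs | hs <;> linarith)
      linarith
    · linarith

end Supports

/-! ### Minimality and uniqueness. -/

theorem mainTheorem6 (d : ℕ)
    (μ₁ μ₂ ν₁ ν₂ : Measure (EuclideanSpace ℝ (Fin d)))
    [IsProbabilityMeasure μ₁] [IsProbabilityMeasure μ₂]
    [IsProbabilityMeasure ν₁] [IsProbabilityMeasure ν₂]
    (hμ₁ : Bornology.IsBounded μ₁.support) (hμ₂ : Bornology.IsBounded μ₂.support)
    (hν₁ : Bornology.IsBounded ν₁.support) (hν₂ : Bornology.IsBounded ν₂.support)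
    (hμ : Disjoint μ₁.support μ₂.support) (hν : Disjoint ν₁.support ν₂.support)
    (pstar : ℝ) (hp : pstar ∈ Set.Ioo (0 : ℝ) 1)
    (hL₁ : supportDist μ₁ ν₁ +
        supportDiam ν₁ + supportDiam ν₂ + supportDiam μ₁ + supportDiam μ₂ ≤ supportDist μ₁ ν₂)
    (hL₂ : supportDist μ₂ ν₂ +
        supportDiam ν₁ + supportDiam ν₂ + supportDiam μ₁ + supportDiam μ₂ ≤ supportDist μ₂ ν₁) :
    pstar ∈ argminOn
        (fun p : ℝ => wasserstein1 (mixture pstar μ₁ μ₂) (mixture p ν₁ ν₂)) (Set.Icc 0 1) ∧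
    (((0 < supportDiam μ₁ ∨ 0 < supportDiam ν₁) ∧ (0 < supportDiam μ₂ ∨ 0 < supportDiam ν₂)) ∨
      (supportDist μ₁ ν₁ +
          supportDiam ν₁ + supportDiam ν₂ + supportDiam μ₁ + supportDiam μ₂ < supportDist μ₁ ν₂ ∧
        supportDist μ₂ ν₂ +
          supportDiam ν₁ + supportDiam ν₂ + supportDiam μ₁ + supportDiam μ₂ < supportDist μ₂ ν₁) →
      argminOn
        (fun p : ℝ => wasserstein1 (mixture pstar μ₁ μ₂) (mixture p ν₁ ν₂)) (Set.Icc 0 1)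
          = {pstar}) := by
  have up : ∀ p : ℝ, pstar < p → _ := fun p h =>
    wasserstein1_mixture_increase hμ₁ hμ₂ hν₁ hν₂ hμ hν hL₁ hL₂ hp.1 h
  -- Exchanging the indices turns the weights into `1 - pstar < 1 - p`, so lowering the weight
  -- becomes raising it.
  have down : ∀ p : ℝ, p < pstar → _ := fun p h =>
    wasserstein1_mixture_increase hμ₂ hμ₁ hν₂ hν₁ hμ.symm hν.symm (by linarith) (by linarith)
      (sub_pos.2 hp.2) (sub_lt_sub_left h 1)
  simp only [mixture_one_sub] at down
  have hmin : pstar ∈ argminOn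
      (fun p : ℝ => wasserstein1 (mixture pstar μ₁ μ₂) (mixture p ν₁ ν₂)) (Set.Icc 0 1) := by
    refine ⟨⟨hp.1.le, hp.2.le⟩, fun p _ => ?_⟩
    rcases lt_trichotomy p pstar with h | rfl | h
    · exact (down p h).1
    · exact le_rfl
    · exact (up p h).1
  refine ⟨hmin, fun hs => Set.eq_singleton_iff_unique_mem.2 ⟨hmin, fun p hp' => ?_⟩⟩
  rcases lt_trichotomy p pstar with h | h | h
  · refine absurd (hp'.2 pstar hmin.1) (not_le_of_gt ((down p h).2 ?_))
    exact hs.imp (fun hs => hs.2) fun hs => by linarith [hs.1]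
  · exact h
  · refine absurd (hp'.2 pstar hmin.1) (not_le_of_gt ((up p h).2 ?_))
    exact hs.imp (fun hs => hs.1) fun hs => hs.2
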